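/- Let $\mathbb K\in\{\mathbb R,\mathbb C\}$, $N\ge 1$, let $\Omega\subseteq\mathbb R^N$ be open and bounded, and let $0<\alpha<\beta$. All function spaces are $\mathbb K$-valued and inner products are anti-linear in the first argument. Let $H^1_0(\Omega)$ be the closure of $C_c^\infty(\Omega)$ in $H^1(\Omega)$, let $H^{-1}(\Omega)$ be its dual, put $g_0(\Omega):=\{\nabla u: u\in H_0^1(\Omega)\}\subseteq L^2(\Omega)^N$, and let $\iota_{g_0}\colon g_0(\Omega)\to L^2(\Omega)^N$ be the canonical embedding. Set $$M(\alpha,\beta,\Omega):=\{a\in L^\infty(\Omega;\mathbb K^{N\times N}):\ \operatorname{Re}a(x)\ge\alpha,\ \operatorname{Re}a(x)^{-1}\ge 1/\beta\ \text{for a.e. }x\in\Omega\},$$ and let $M_{\rm sym}(\alpha,\beta,\Omega)$ be the set of those $a\in M(\alpha,\beta,\Omega)$ for which $a(x)$ is real and symmetric for a.e. $x$. A coefficient $a$ is identified with the operator of multiplication by $a$ on $L^2(\Omega)^N$. For $(a_n)_n$ and $a$ in $M_{\rm sym}(\alpha,\beta,\Omega)$, $(a_n)_n$ *$G$-converges*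 to $a$ if for all $f\in H^{-1}(\Omega)$ and all $u_n\in H_0^1(\Omega)$ with $\langle a_n\nabla u_n,\nabla\phi\rangle=f(\phi)$ for all $\phi\in H^1_0(\Omega)$ and $n\in\mathbb N$, one has $u_n\rightharpoonup u$ in $H_0^1(\Omega)$ for some $u\in H^1_0(\Omega)$ with $\langle a\nabla u,\nabla\phi\rangle=f(\phi)$ for all $\phi\in H_0^1(\Omega)$. For $(a_n)_n$ and $a$ in $M(\alpha,\beta,\Omega)$, $(a_n)_n$ *$H$-converges* to $a$ if, under the same premise, in addition $a_n\nabla u_n\rightharpoonup a\nabla u$ in $L^2(\Omega)^N$ for this $u$. Then $g_0(\Omega)$ is a Hilbert space (a closed subspace of $L^2(\Omega)^N$), for each $a\in M(\alpha,\beta,\Omega)$ the operator $\iota_{g_0}^*a\iota_{g_0}$ is boundedly invertible on $g_0(\Omega)$, and the following hold. (a) Let $(a_n)_n$ and $a$ be in $M_{\rm sym}(\alpha,\beta,\Omega)$. Then $(a_n)_n$ $G$-converges to $a$ if and only if $(\iota_{g_0}^*a_n\iota_{g_0})^{-1}\to(\iota_{g_0}^*a\iota_{g_0})^{-1}$ in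 the weak operator topology of $\mathcal B(g_0(\Omega))$. (b) Let $(a_n)_n$ and $a$ be in $M(\alpha,\beta,\Omega)$. Then $(a_n)_n$ $H$-converges to $a$ if and only if $(\iota_{g_0}^*a_n\iota_{g_0})^{-1}\to(\iota_{g_0}^*a\iota_{g_0})^{-1}$ in the weak operator topology of $\mathcal B(g_0(\Omega))$ and $a_n\iota_{g_0}(\iota_{g_0}^*a_n\iota_{g_0})^{-1}\to a\iota_{g_0}(\iota_{g_0}^*a\iota_{g_0})^{-1}$ in the weak operator topology of $\mathcal B(g_0(\Omega),L^2(\Omega)^N)$. -/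

import Mathlib

namespace Homogenisation

open MeasureTheory TopologicalSpace Filter Topology
open scoped Distributions ENNReal

noncomputable section

/-- The space `𝕜^N`, with its Euclidean inner product. -/
abbrev Vec (𝕜 : Type*) [RCLike 𝕜] (N : ℕ) : Type _ := EuclideanSpace 𝕜 (Fin N)

/-- Lebesgue measure on `Ω`. -/
abbrev vol {N : ℕ} (Ω : Opens (Vec ℝ N)) : Measure (Vec ℝ N) :=
  volume.restrict (Ω : Set (Vec ℝ N))

/-- The Hilbert space `L²(Ω)`. -/
abbrev L2 (𝕜 : Type*) [RCLike 𝕜] {N : ℕ} (Ω : Opens (Vec ℝ N)) : Type _ :=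
  Lp 𝕜 2 (vol Ω)

/-- The Hilbert space `L²(Ω)^N`. -/
abbrev L2Vec (𝕜 : Type*) [RCLike 𝕜] {N : ℕ} (Ω : Opens (Vec ℝ N)) : Type _ :=
  Lp (Vec 𝕜 N) 2 (vol Ω)

/-- The partial derivative `∂ᵢ φ` of a test function. -/
def partialDeriv {𝕜 : Type*} [RCLike 𝕜] {N : ℕ} {Ω : Opens (Vec ℝ N)}
    (φ : 𝓓(Ω, 𝕜)) (i : Fin N) (x : Vec ℝ N) : 𝕜 :=
  fderiv ℝ φ x (EuclideanSpace.single i (1 : ℝ))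

/-- `v` is the weak gradient of `u` on `Ω`. -/
def IsWeakGradient {𝕜 : Type*} [RCLike 𝕜] {N : ℕ} {Ω : Opens (Vec ℝ N)}
    (u : L2 𝕜 Ω) (v : L2Vec 𝕜 Ω) : Prop :=
  ∀ (φ : 𝓓(Ω, 𝕜)) (i : Fin N),
    ∫ x, u x * partialDeriv φ i x ∂(vol Ω) = -∫ x, v x i * φ x ∂(vol Ω)

theorem continuous_partialDeriv {𝕜 : Type*} [RCLike 𝕜] {N : ℕ} {Ω : Opens (Vec ℝ N)}
    (φ : 𝓓(Ω, 𝕜)) (i : Fin N) : Continuous (partialDeriv φ i) :=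
  (φ.contDiff.continuous_fderiv (by simp)).clm_apply continuous_const

theorem integrable_mul_partialDeriv {𝕜 : Type*} [RCLike 𝕜] {N : ℕ} {Ω : Opens (Vec ℝ N)}
    (u : L2 𝕜 Ω) (φ : 𝓓(Ω, 𝕜)) (i : Fin N) :
    Integrable (fun x => u x * partialDeriv φ i x) (vol Ω) := by
  have h : MemLp (partialDeriv φ i) 2 (vol Ω) :=
    (continuous_partialDeriv φ i).memLp_of_hasCompactSupport
      (φ.hasCompactSupport.fderiv_apply ℝ _)
  exact (Lp.memLp u).integrable_mul h

theorem integrable_coord_mul {𝕜 : Type*} [RCLike 𝕜] {N : ℕ} {Ω : Opens (Vec ℝ N)}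
    (v : L2Vec 𝕜 Ω) (φ : 𝓓(Ω, 𝕜)) (i : Fin N) :
    Integrable (fun x => v x i * φ x) (vol Ω) := by
  have h : MemLp (φ : Vec ℝ N → 𝕜) 2 (vol Ω) :=
    φ.continuous.memLp_of_hasCompactSupport φ.hasCompactSupport
  have h' : MemLp (fun x => v x i) 2 (vol Ω) :=
    (Lp.memLp v).continuousLinearMap_comp (EuclideanSpace.proj (𝕜 := 𝕜) i)
  exact h'.integrable_mul h

/-- The Sobolev space `H¹(Ω)`: an element is recorded as the pair `(u, grad u)` of a function in
`L²(Ω)` and its weak gradient in `L²(Ω)^N`, so that the inherited norm is the usual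
norm `(‖u‖² + ‖grad u‖²)^(1/2)`. -/
def H1 (𝕜 : Type*) [RCLike 𝕜] {N : ℕ} (Ω : Opens (Vec ℝ N)) :
    Submodule 𝕜 (WithLp 2 (L2 𝕜 Ω × L2Vec 𝕜 Ω)) where
  carrier := {p | IsWeakGradient p.fst p.snd}
  zero_mem' := by
    intro φ i
    have h1 : ∫ x, (0 : L2 𝕜 Ω) x * partialDeriv φ i x ∂(vol Ω) = 0 := by
      refine integral_eq_zero_of_ae ?_
      filter_upwards [Lp.coeFn_zero 𝕜 2 (vol Ω)] with x hx
      rw [hx]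
      simp
    have h2 : ∫ x, (0 : L2Vec 𝕜 Ω) x i * φ x ∂(vol Ω) = 0 := by
      refine integral_eq_zero_of_ae ?_
      filter_upwards [Lp.coeFn_zero (Vec 𝕜 N) 2 (vol Ω)] with x hx
      rw [hx]
      simp
    change ∫ x, (0 : L2 𝕜 Ω) x * partialDeriv φ i x ∂(vol Ω)
      = -∫ x, (0 : L2Vec 𝕜 Ω) x i * φ x ∂(vol Ω)
    rw [h1, h2, neg_zero]
  add_mem' := by
    intro p q hp hq φ i
    have h1 : ∫ x, (p.fst + q.fst) x * partialDeriv φ i x ∂(vol Ω)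
        = ∫ x, p.fst x * partialDeriv φ i x ∂(vol Ω)
          + ∫ x, q.fst x * partialDeriv φ i x ∂(vol Ω) := by
      rw [← integral_add (integrable_mul_partialDeriv _ φ i) (integrable_mul_partialDeriv _ φ i)]
      refine integral_congr_ae ?_
      filter_upwards [Lp.coeFn_add p.fst q.fst] with x hx
      rw [hx]
      simp [add_mul]
    have h2 : ∫ x, (p.snd + q.snd) x i * φ x ∂(vol Ω)
        = ∫ x, p.snd x i * φ x ∂(vol Ω) + ∫ x, q.snd x i * φ x ∂(vol Ω) := by
      rw [← integral_add (integrable_coord_mul _ φ i) (integrable_coord_mul _ φ i)]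
      refine integral_congr_ae ?_
      filter_upwards [Lp.coeFn_add p.snd q.snd] with x hx
      rw [hx]
      simp [add_mul]
    change ∫ x, (p.fst + q.fst) x * partialDeriv φ i x ∂(vol Ω)
      = -∫ x, (p.snd + q.snd) x i * φ x ∂(vol Ω)
    rw [h1, h2, hp φ i, hq φ i, neg_add]
  smul_mem' := by
    intro c p hp φ i
    have h1 : ∫ x, (c • p.fst) x * partialDeriv φ i x ∂(vol Ω)
        = c * ∫ x, p.fst x * partialDeriv φ i x ∂(vol Ω) := by
      rw [← integral_const_mul]
      refine integral_congr_ae ?_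
      filter_upwards [Lp.coeFn_smul c p.fst] with x hx
      rw [hx]
      simp [mul_assoc]
    have h2 : ∫ x, (c • p.snd) x i * φ x ∂(vol Ω) = c * ∫ x, p.snd x i * φ x ∂(vol Ω) := by
      rw [← integral_const_mul]
      refine integral_congr_ae ?_
      filter_upwards [Lp.coeFn_smul c p.snd] with x hx
      rw [hx]
      simp [mul_assoc]
    change ∫ x, (c • p.fst) x * partialDeriv φ i x ∂(vol Ω)
      = -∫ x, (c • p.snd) x i * φ x ∂(vol Ω)
    rw [h1, h2, hp φ i, mul_neg]

/-- `H¹₀(Ω)`: the closure of the test functions `C_c^∞(Ω)` in `H¹(Ω)`. -/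
def H10 (𝕜 : Type*) [RCLike 𝕜] {N : ℕ} (Ω : Opens (Vec ℝ N)) : Submodule 𝕜 (H1 𝕜 Ω) :=
  (Submodule.span 𝕜
    {p : H1 𝕜 Ω | ∃ φ : 𝓓(Ω, 𝕜), p.1.fst =ᵐ[vol Ω] φ}).topologicalClosure

/-- The gradient `H¹₀(Ω) → L²(Ω)^N`. -/
def grad (𝕜 : Type*) [RCLike 𝕜] {N : ℕ} (Ω : Opens (Vec ℝ N)) : H10 𝕜 Ω →L[𝕜] L2Vec 𝕜 Ω :=
  WithLp.sndL 2 𝕜 (L2 𝕜 Ω) (L2Vec 𝕜 Ω) ∘L (H1 𝕜 Ω).subtypeL ∘L (H10 𝕜 Ω).subtypeL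

/-- `g₀(Ω) = grad[H¹₀(Ω)]`. -/
def g0 (𝕜 : Type*) [RCLike 𝕜] {N : ℕ} (Ω : Opens (Vec ℝ N)) : Submodule 𝕜 (L2Vec 𝕜 Ω) :=
  (grad 𝕜 Ω).range

/-- The canonical embedding of `g₀(Ω)` into `L²(Ω)^N`. -/
def iota (𝕜 : Type*) [RCLike 𝕜] {N : ℕ} (Ω : Opens (Vec ℝ N)) : g0 𝕜 Ω →L[𝕜] L2Vec 𝕜 Ω :=
  (g0 𝕜 Ω).subtypeL

/-- Coefficients `L^∞(Ω)^{N × N}`; an `N × N` matrix is identified with the linear map on `𝕜^N`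
that it induces. -/
abbrev Coeff (𝕜 : Type*) [RCLike 𝕜] {N : ℕ} (Ω : Opens (Vec ℝ N)) : Type _ :=
  Lp (Vec 𝕜 N →L[𝕜] Vec 𝕜 N) ∞ (vol Ω)

/-- The operator `q ↦ (x ↦ a(x) q(x))` of multiplication by the coefficient `a` on `L²(Ω)^N`. -/
def mulOp {𝕜 : Type*} [RCLike 𝕜] {N : ℕ} {Ω : Opens (Vec ℝ N)} (a : Coeff 𝕜 Ω) :
    L2Vec 𝕜 Ω →L[𝕜] L2Vec 𝕜 Ω :=
  (ContinuousLinearMap.id 𝕜 (Vec 𝕜 N →L[𝕜] Vec 𝕜 N)).holderL (vol Ω) ∞ 2 2 a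

/-- The admissible coefficients `M(α, β, Ω)`: `Re a(x) ≥ α` and `Re a(x)⁻¹ ≥ 1/β` for almost
every `x ∈ Ω`. -/
def M (𝕜 : Type*) [RCLike 𝕜] {N : ℕ} (α β : ℝ) (Ω : Opens (Vec ℝ N)) : Set (Coeff 𝕜 Ω) :=
  {a | ∀ᵐ x ∂(vol Ω), (a x).IsInvertible ∧
    (∀ ξ : Vec 𝕜 N, α * ‖ξ‖ ^ 2 ≤ RCLike.re (inner 𝕜 (a x ξ) ξ)) ∧
    (∀ ξ : Vec 𝕜 N, 1 / β * ‖ξ‖ ^ 2 ≤ RCLike.re (inner 𝕜 ((a x).inverse ξ) ξ))}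

/-- The real symmetric admissible coefficients `M_sym(α, β, Ω)`. -/
def Msym (𝕜 : Type*) [RCLike 𝕜] {N : ℕ} (α β : ℝ) (Ω : Opens (Vec ℝ N)) : Set (Coeff 𝕜 Ω) :=
  {a | a ∈ M 𝕜 α β Ω ∧ ∀ᵐ x ∂(vol Ω), ∃ B : Matrix (Fin N) (Fin N) ℝ,
    B.IsSymm ∧ a x = Matrix.toEuclideanCLM (𝕜 := 𝕜) (B.map (algebraMap ℝ 𝕜))}

/-- `u ∈ H¹₀(Ω)` satisfies `⟨a grad u, grad φ⟩ = f(φ)` for all `φ ∈ H¹₀(Ω)`, where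
`f ∈ H⁻¹(Ω) = H¹₀(Ω)*`. -/
def IsSolution {𝕜 : Type*} [RCLike 𝕜] {N : ℕ} {Ω : Opens (Vec ℝ N)} (a : Coeff 𝕜 Ω)
    (f : StrongDual 𝕜 (H10 𝕜 Ω)) (u : H10 𝕜 Ω) : Prop :=
  ∀ φ : H10 𝕜 Ω, inner 𝕜 (mulOp a (grad 𝕜 Ω u)) (grad 𝕜 Ω φ) = f φ

/-- Weak convergence `x n ⇀ y` of a sequence. -/
def WeaklyTendsto (𝕜 : Type*) [RCLike 𝕜] {H : Type*} [NormedAddCommGroup H]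
    [InnerProductSpace 𝕜 H] (x : ℕ → H) (y : H) : Prop :=
  Tendsto (fun n => toWeakSpace 𝕜 H (x n)) atTop (𝓝 (toWeakSpace 𝕜 H y))

/-- `G`-convergence of coefficients. -/
def GConverges {𝕜 : Type*} [RCLike 𝕜] {N : ℕ} {Ω : Opens (Vec ℝ N)} (a : ℕ → Coeff 𝕜 Ω)
    (b : Coeff 𝕜 Ω) : Prop :=
  ∀ (f : StrongDual 𝕜 (H10 𝕜 Ω)) (u : ℕ → H10 𝕜 Ω), (∀ n, IsSolution (a n) f (u n)) →
    ∃ v : H10 𝕜 Ω, WeaklyTendsto 𝕜 u v ∧ IsSolution b f v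

/-- `H`-convergence of coefficients. -/
def HConverges {𝕜 : Type*} [RCLike 𝕜] {N : ℕ} {Ω : Opens (Vec ℝ N)} (a : ℕ → Coeff 𝕜 Ω)
    (b : Coeff 𝕜 Ω) : Prop :=
  ∀ (f : StrongDual 𝕜 (H10 𝕜 Ω)) (u : ℕ → H10 𝕜 Ω), (∀ n, IsSolution (a n) f (u n)) →
    ∃ v : H10 𝕜 Ω, WeaklyTendsto 𝕜 u v ∧
      WeaklyTendsto 𝕜 (fun n => mulOp (a n) (grad 𝕜 Ω (u n))) (mulOp b (grad 𝕜 Ω v)) ∧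
      IsSolution b f v

/-- The operator `ι* a ι` on `g₀(Ω)`, where `ι` is the canonical embedding. -/
def compression {𝕜 : Type*} [RCLike 𝕜] {N : ℕ} {Ω : Opens (Vec ℝ N)} [CompleteSpace (g0 𝕜 Ω)]
    (a : Coeff 𝕜 Ω) : g0 𝕜 Ω →L[𝕜] g0 𝕜 Ω :=
  ContinuousLinearMap.adjoint (iota 𝕜 Ω) ∘L mulOp a ∘L iota 𝕜 Ω

/-- Convergence of a sequence of bounded operators in the weak operator topology. -/
def WOTTendsto {𝕜 : Type*} [RCLike 𝕜] {H K : Type*} [NormedAddCommGroup H]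
    [InnerProductSpace 𝕜 H] [NormedAddCommGroup K] [InnerProductSpace 𝕜 K]
    (T : ℕ → H →L[𝕜] K) (S : H →L[𝕜] K) : Prop :=
  Tendsto (fun n => ContinuousLinearMapWOT.ofCLM (T n)) atTop
    (𝓝 (ContinuousLinearMapWOT.ofCLM S))

end

end Homogenisation

open Homogenisation

namespace Homogenisation

open MeasureTheory TopologicalSpace Filter Topology
open scoped Distributions ENNReal ComplexConjugate

variable {𝕜 : Type*} [RCLike 𝕜] {N : ℕ} {Ω : Opens (Vec ℝ N)}

/-! On a bounded domain the Poincaré inequality makes the gradient bounded below on the complete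
space `H10`. Its range `g0` is therefore closed, and the gradient becomes an isomorphism `J : H10 ≃L
g0`.

By Riesz, every `f ∈ H⁻¹` has the form `f φ = ⟨g, J φ⟩` with `g ∈ g0`, and every `g` occurs. Since
`⟨a grad u, grad φ⟩ = ⟨ι* a ι (J u), J φ⟩`, the variational problem is the equation `ι* a ι (J u) =
g`. Coercivity of `a` passes to `ι* a ι`, which is invertible by Lax–Milgram, so the unique solution
is `J u = (ι* a ι)⁻¹ g` (`isSolution_iff`).

Bounded operators preserve weak convergence, so `u n ⇀ v` in `H10` is equivalent to `J (u n) ⇀ J v`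
in `g0`. Letting `f`, equivalently `g`, vary turns convergence of the solutions, and of the fluxes
`a n ι (ι* (a n) ι)⁻¹ g`, into weak operator convergence. -/

/-! ### Completeness of `H1` and `H10`. -/

theorem continuous_integral_mul {g : Vec ℝ N → 𝕜} (hg : MemLp g 2 (vol Ω)) :
    Continuous fun u : L2 𝕜 Ω => ∫ x, u x * g x ∂(vol Ω) := by
  have hg' : MemLp (fun x => conj (g x)) 2 (vol Ω) := hg.star
  have h : (fun u : L2 𝕜 Ω => ∫ x, u x * g x ∂(vol Ω)) =
      fun u : L2 𝕜 Ω => inner 𝕜 (hg'.toLp _) u := by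
    funext u
    rw [L2.inner_def]
    refine integral_congr_ae ?_
    filter_upwards [hg'.coeFn_toLp] with x hx
    rw [hx, RCLike.inner_apply, RCLike.conj_conj]
  rw [h]
  fun_prop

theorem continuous_integral_coord_mul {g : Vec ℝ N → 𝕜} (hg : MemLp g 2 (vol Ω)) (i : Fin N) :
    Continuous fun v : L2Vec 𝕜 Ω => ∫ x, v x i * g x ∂(vol Ω) := by
  have h : (fun v : L2Vec 𝕜 Ω => ∫ x, v x i * g x ∂(vol Ω)) =
      fun v : L2Vec 𝕜 Ω =>
        ∫ x, ((EuclideanSpace.proj (𝕜 := 𝕜) i).compLpL 2 (vol Ω) v) x * g x ∂(vol Ω) := by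
    funext v
    refine integral_congr_ae ?_
    filter_upwards [(EuclideanSpace.proj (𝕜 := 𝕜) i).coeFn_compLpL v] with x hx
    rw [hx]
    rfl
  rw [h]
  exact (continuous_integral_mul hg).comp (ContinuousLinearMap.continuous _)

/-- Each test function and index imposes one equation between quantities continuous in the pair `(u,
grad u)` for the `L²` norms. -/
theorem isClosed_H1 : IsClosed (H1 𝕜 Ω : Set (WithLp 2 (L2 𝕜 Ω × L2Vec 𝕜 Ω))) := by
  have h : (H1 𝕜 Ω : Set (WithLp 2 (L2 𝕜 Ω × L2Vec 𝕜 Ω))) =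
      ⋂ (φ : 𝓓(Ω, 𝕜)) (i : Fin N), {p | ∫ x, p.fst x * partialDeriv φ i x ∂(vol Ω) =
        -∫ x, p.snd x i * φ x ∂(vol Ω)} := by
    ext p
    simp only [Set.mem_iInter, Set.mem_ofPred_eq]
    rfl
  rw [h]
  refine isClosed_iInter fun φ => isClosed_iInter fun i => isClosed_eq ?_ ?_
  · exact (continuous_integral_mul ((continuous_partialDeriv φ i).memLp_of_hasCompactSupport
      (φ.hasCompactSupport.fderiv_apply ℝ _))).comp
      (WithLp.fstL 2 𝕜 (L2 𝕜 Ω) (L2Vec 𝕜 Ω)).continuous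
  · exact ((continuous_integral_coord_mul
      (φ.continuous.memLp_of_hasCompactSupport φ.hasCompactSupport) i).comp
      (WithLp.sndL 2 𝕜 (L2 𝕜 Ω) (L2Vec 𝕜 Ω)).continuous).neg

instance completeSpace_H1 : CompleteSpace (H1 𝕜 Ω) :=
  isClosed_H1.completeSpace_coe

instance completeSpace_H10 : CompleteSpace (H10 𝕜 Ω) :=
  (Submodule.isClosed_topologicalClosure _).completeSpace_coe

/-! ### The Poincaré inequality. -/

/-- The test function `x ↦ xᵢ * conj (φ x)`. -/
noncomputable def coordMulConj (φ : 𝓓(Ω, 𝕜)) (i : Fin N) : 𝓓(Ω, 𝕜) where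
  toFun x := (x i) • conj (φ x)
  contDiff' := by
    have h1 : ContDiff ℝ ((⊤ : ℕ∞) : WithTop ℕ∞) fun x : Vec ℝ N => x i :=
      (EuclideanSpace.proj (𝕜 := ℝ) i).contDiff
    have h2 : ContDiff ℝ ((⊤ : ℕ∞) : WithTop ℕ∞) fun x : Vec ℝ N => conj (φ x) :=
      (RCLike.conjCLE (K := 𝕜)).contDiff.comp φ.contDiff
    exact h1.smul h2
  hasCompactSupport' := by
    refine φ.hasCompactSupport.mono fun x hx => ?_
    contrapose! hx
    simp_all
  tsupport_subset' := by
    refine (closure_mono fun x hx => ?_).trans φ.tsupport_subset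
    contrapose! hx
    simp_all

theorem coordMulConj_apply (φ : 𝓓(Ω, 𝕜)) (i : Fin N) (x : Vec ℝ N) :
    coordMulConj φ i x = (x i) • conj (φ x) := rfl

theorem partialDeriv_coordMulConj (φ : 𝓓(Ω, 𝕜)) (i : Fin N) (x : Vec ℝ N) :
    partialDeriv (coordMulConj φ i) i x =
      conj (φ x) + (x i) • conj (partialDeriv φ i x) := by
  have h1 : HasFDerivAt (fun x : Vec ℝ N => x i) (EuclideanSpace.proj (𝕜 := ℝ) i) x :=
    (EuclideanSpace.proj (𝕜 := ℝ) i).hasFDerivAt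
  have h0 : HasFDerivAt (φ : Vec ℝ N → 𝕜) (fderiv ℝ φ x) x :=
    (φ.contDiff.differentiable (by simp) x).hasFDerivAt
  have h2 := (RCLike.conjCLE (K := 𝕜)).hasFDerivAt.comp x h0
  have h3 := (h1.smul h2).fderiv
  have h4 : (coordMulConj φ i : Vec ℝ N → 𝕜) =
      (fun x : Vec ℝ N => x i) • (⇑(RCLike.conjCLE (K := 𝕜)) ∘ φ) := rfl
  rw [partialDeriv, h4, h3]
  simp [partialDeriv, add_comm]

theorem integral_mul_partialDeriv (φ ψ : 𝓓(Ω, 𝕜)) (i : Fin N) :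
    ∫ x, φ x * partialDeriv ψ i x ∂(vol Ω) = -∫ x, partialDeriv φ i x * ψ x ∂(vol Ω) := by
  have hφ : ∀ x, x ∉ (Ω : Set (Vec ℝ N)) → φ x = 0 := fun x hx =>
    image_eq_zero_of_notMem_tsupport fun h => hx (φ.tsupport_subset h)
  have hψ : ∀ x, x ∉ (Ω : Set (Vec ℝ N)) → ψ x = 0 := fun x hx =>
    image_eq_zero_of_notMem_tsupport fun h => hx (ψ.tsupport_subset h)
  -- Both integrands vanish off `Ω`, so integration by parts can be done on the whole space, with no
  -- boundary term.
  rw [setIntegral_eq_integral_of_forall_compl_eq_zero fun x hx => by rw [hφ x hx, zero_mul],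
    setIntegral_eq_integral_of_forall_compl_eq_zero fun x hx => by rw [hψ x hx, mul_zero]]
  refine integral_mul_fderiv_eq_neg_fderiv_mul_of_integrable ?_ ?_ ?_
    (fun x _ => φ.contDiff.differentiable (by simp) x)
    (fun x _ => ψ.contDiff.differentiable (by simp) x)
  · exact ((continuous_partialDeriv φ i).mul ψ.continuous).integrable_of_hasCompactSupport
      ψ.hasCompactSupport.mul_left
  · exact (φ.continuous.mul (continuous_partialDeriv ψ i)).integrable_of_hasCompactSupport
      φ.hasCompactSupport.mul_right
  · exact (φ.continuous.mul ψ.continuous).integrable_of_hasCompactSupport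
      φ.hasCompactSupport.mul_right

theorem L2_norm_sq_eq_integral {X E : Type*} [MeasurableSpace X] {μ : Measure X}
    [NormedAddCommGroup E] [InnerProductSpace 𝕜 E] (f : Lp E 2 μ) :
    ‖f‖ ^ 2 = ∫ x, ‖f x‖ ^ 2 ∂μ := by
  have h := inner_self_eq_norm_sq_to_K (𝕜 := 𝕜) f
  rw [L2.inner_def] at h
  simp only [inner_self_eq_norm_sq_to_K] at h
  have h2 : ∫ x, ((‖f x‖ : 𝕜)) ^ 2 ∂μ = ((∫ x, ‖f x‖ ^ 2 ∂μ : ℝ) : 𝕜) := by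
    rw [← integral_ofReal]
    simp
  rw [h2] at h
  exact_mod_cast h.symm

/-- The Poincaré inequality for test functions. -/
theorem IsWeakGradient.norm_sq_le {u : L2 𝕜 Ω} {v : L2Vec 𝕜 Ω} (h : IsWeakGradient u v)
    {φ : 𝓓(Ω, 𝕜)} (hu : u =ᵐ[vol Ω] φ) {i : Fin N} {R : ℝ} (hR : ∀ x ∈ Ω, |x i| ≤ R) :
    ‖u‖ ^ 2 ≤ 4 * R ^ 2 * ‖v‖ ^ 2 := by
  set ψ := coordMulConj φ i
  -- Testing the weak gradient against `ψ` means that `v` never has to be identified with the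
  -- classical gradient of `φ`.
  have hweak : ∫ x, φ x * partialDeriv ψ i x ∂(vol Ω) = -∫ x, v x i * ψ x ∂(vol Ω) := by
    rw [← h ψ i]
    refine integral_congr_ae ?_
    filter_upwards [hu] with x hx
    rw [hx]
  have hparts := integral_mul_partialDeriv φ ψ i
  have hcoord : Continuous fun x : Vec ℝ N => x i := (EuclideanSpace.proj (𝕜 := ℝ) i).continuous
  have hconj : ∫ x, partialDeriv φ i x * ψ x ∂(vol Ω) =
      conj (∫ x, φ x * (x i • conj (partialDeriv φ i x)) ∂(vol Ω)) := by
    rw [← integral_conj]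
    refine integral_congr_ae (.of_forall fun x => ?_)
    simp only [ψ, coordMulConj_apply, map_mul, RCLike.real_smul_eq_coe_mul, RCLike.conj_conj,
      RCLike.conj_ofReal]
    ring
  have hsplit : ∫ x, φ x * partialDeriv ψ i x ∂(vol Ω) =
      ((‖u‖ ^ 2 : ℝ) : 𝕜) + ∫ x, φ x * (x i • conj (partialDeriv φ i x)) ∂(vol Ω) := by
    have h1 : ((‖u‖ ^ 2 : ℝ) : 𝕜) = ∫ x, φ x * conj (φ x) ∂(vol Ω) := by
      rw [L2_norm_sq_eq_integral (𝕜 := 𝕜), ← integral_ofReal]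
      refine integral_congr_ae ?_
      filter_upwards [hu] with x hx
      rw [hx, RCLike.mul_conj]
      simp
    rw [h1, ← integral_add]
    · refine integral_congr_ae (.of_forall fun x => ?_)
      simp only [ψ, partialDeriv_coordMulConj, mul_add]
    · exact ((φ.continuous.mul (RCLike.continuous_conj.comp
        φ.continuous)).integrable_of_hasCompactSupport φ.hasCompactSupport.mul_right).restrict
    · exact ((φ.continuous.mul (hcoord.smul (RCLike.continuous_conj.comp
        (continuous_partialDeriv φ i)))).integrable_of_hasCompactSupport
        φ.hasCompactSupport.mul_right).restrict
  set V := ∫ x, v x i * ψ x ∂(vol Ω) with hV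
  set B := ∫ x, φ x * (x i • conj (partialDeriv φ i x)) ∂(vol Ω)
  -- The product rule gives `‖u‖² + B = -V`, and integration by parts gives `V = conj B`; take real
  -- parts.
  have hre : ‖u‖ ^ 2 = -(2 * RCLike.re V) := by
    have h1 : RCLike.re V = RCLike.re B := by
      have : V = conj B := by
        rw [← hconj, ← neg_inj, ← hparts, hweak]
      rw [this, RCLike.conj_re]
    have h2 := congrArg RCLike.re (hsplit.symm.trans hweak)
    rw [map_add, map_neg, RCLike.ofReal_re] at h2
    linarith
  have hu2 : Integrable (fun x => ‖u x‖ ^ 2) (vol Ω) := (Lp.memLp u).integrable_norm_pow (by simp)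
  have hv2 : Integrable (fun x => ‖v x‖ ^ 2) (vol Ω) := (Lp.memLp v).integrable_norm_pow (by simp)
  -- Young's inequality with weight `1/4`: doubling `V` produces `‖u‖²/2`, which is absorbed on the
  -- left and leaves the constant `4 R²`.
  have hle : ‖V‖ ≤ R ^ 2 * ‖v‖ ^ 2 + 1 / 4 * ‖u‖ ^ 2 := by
    rw [L2_norm_sq_eq_integral (𝕜 := 𝕜) u, L2_norm_sq_eq_integral (𝕜 := 𝕜) v,
      ← integral_const_mul, ← integral_const_mul,
      ← integral_add (hv2.const_mul _) (hu2.const_mul _)]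
    refine norm_integral_le_of_norm_le ((hv2.const_mul _).add (hu2.const_mul _)) ?_
    filter_upwards [hu, ae_restrict_mem Ω.isOpen.measurableSet] with x hx hxΩ
    have h1 : ‖v x i * ψ x‖ = ‖v x i‖ * (|x i| * ‖u x‖) := by
      rw [norm_mul, coordMulConj_apply, norm_smul, RCLike.norm_conj, Real.norm_eq_abs, hx]
    rw [h1]
    have h2 : ‖v x i‖ * (|x i| * ‖u x‖) ≤ ‖v x‖ * (R * ‖u x‖) := by
      gcongr
      · exact PiLp.norm_apply_le _ _
      · exact hR x hxΩ
    refine h2.trans ?_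
    nlinarith [sq_nonneg (R * ‖v x‖ - 1 / 2 * ‖u x‖)]
  have := (abs_le.1 ((RCLike.abs_re_le_norm V).trans hle)).1
  linarith

theorem exists_norm_sq_le_norm_grad (hN : 1 ≤ N)
    (hΩ : Bornology.IsBounded (Ω : Set (Vec ℝ N))) :
    ∃ C : ℝ, 0 ≤ C ∧ ∀ u : H10 𝕜 Ω, ‖u‖ ^ 2 ≤ C * ‖grad 𝕜 Ω u‖ ^ 2 := by
  obtain ⟨R, hR⟩ := hΩ.exists_norm_le
  let i : Fin N := ⟨0, hN⟩
  -- The extra `1` pays for the gradient part of the `H1` norm.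
  refine ⟨4 * R ^ 2 + 1, by positivity, ?_⟩
  have key : ∀ p ∈ H10 𝕜 Ω, ‖p.1.fst‖ ^ 2 ≤ 4 * R ^ 2 * ‖p.1.snd‖ ^ 2 := by
    intro p hp
    refine closure_minimal (s := (Submodule.span 𝕜
      {p : H1 𝕜 Ω | ∃ φ : 𝓓(Ω, 𝕜), p.1.fst =ᵐ[vol Ω] φ} : Set (H1 𝕜 Ω)))
      (t := {p : H1 𝕜 Ω | ‖p.1.fst‖ ^ 2 ≤ 4 * R ^ 2 * ‖p.1.snd‖ ^ 2}) ?_ ?_ hp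
    -- The generating set is already closed under linear combinations, so elements of the span are
    -- themselves test functions.
    · intro q hq
      obtain ⟨φ, hφ⟩ : ∃ φ : 𝓓(Ω, 𝕜), q.1.fst =ᵐ[vol Ω] φ := by
        induction hq using Submodule.span_induction with
        | mem q hq => exact hq
        | zero => exact ⟨0, Lp.coeFn_zero 𝕜 2 (vol Ω)⟩
        | add q r _ _ hq hr =>
          obtain ⟨φ, hφ⟩ := hq
          obtain ⟨χ, hχ⟩ := hr
          exact ⟨φ + χ, (Lp.coeFn_add q.1.fst r.1.fst).trans (hφ.add hχ)⟩
        | smul c q _ hq =>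
          obtain ⟨φ, hφ⟩ := hq
          exact ⟨c • φ, (Lp.coeFn_smul c q.1.fst).trans (hφ.const_smul c)⟩
      exact IsWeakGradient.norm_sq_le (i := i) q.2 hφ fun x hx =>
        (PiLp.norm_apply_le x i).trans (hR x hx)
    · have h1 : Continuous fun p : H1 𝕜 Ω => p.1.fst :=
        (WithLp.fstL 2 𝕜 (L2 𝕜 Ω) (L2Vec 𝕜 Ω)).continuous.comp continuous_subtype_val
      have h2 : Continuous fun p : H1 𝕜 Ω => p.1.snd :=
        (WithLp.sndL 2 𝕜 (L2 𝕜 Ω) (L2Vec 𝕜 Ω)).continuous.comp continuous_subtype_val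
      exact isClosed_le (h1.norm.pow 2) (continuous_const.mul (h2.norm.pow 2))
  intro u
  have h := WithLp.prod_norm_sq_eq_of_L2 u.1.1
  have hu : ‖u‖ = ‖u.1.1‖ := rfl
  have hg : grad 𝕜 Ω u = u.1.1.snd := rfl
  rw [hu, hg, h]
  linarith [key u.1 u.2]

/-! ### The gradient as an isomorphism from `H10` onto `g0`. -/

theorem exists_antilipschitz_grad (hN : 1 ≤ N)
    (hΩ : Bornology.IsBounded (Ω : Set (Vec ℝ N))) :
    ∃ K, AntilipschitzWith K (grad 𝕜 Ω) := by
  obtain ⟨C, hC, h⟩ := exists_norm_sq_le_norm_grad (𝕜 := 𝕜) hN hΩ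
  refine ⟨Real.toNNReal √C, (grad 𝕜 Ω).antilipschitz_of_bound fun u => ?_⟩
  rw [Real.coe_toNNReal _ (Real.sqrt_nonneg C)]
  refine le_of_sq_le_sq ?_ (by positivity)
  rw [mul_pow, Real.sq_sqrt hC]
  exact h u

theorem completeSpace_g0 (hN : 1 ≤ N) (hΩ : Bornology.IsBounded (Ω : Set (Vec ℝ N))) :
    CompleteSpace (g0 𝕜 Ω) := by
  obtain ⟨K, hK⟩ := exists_antilipschitz_grad (𝕜 := 𝕜) hN hΩ
  exact (hK.isClosed_range (grad 𝕜 Ω).uniformContinuous).completeSpace_coe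

/-- A lower bound gives injectivity; the open mapping theorem then bounds the inverse. -/
theorem exists_equiv_range_of_antilipschitz {E F : Type*} [NormedAddCommGroup E]
    [InnerProductSpace 𝕜 E] [CompleteSpace E] [NormedAddCommGroup F] [InnerProductSpace 𝕜 F]
    (T : E →L[𝕜] F) {K : NNReal} (hT : AntilipschitzWith K T) (G : Submodule 𝕜 F)
    [CompleteSpace G] (hG : ∀ q, q ∈ G ↔ ∃ u, T u = q) :
    ∃ J : E ≃L[𝕜] G, ∀ u, G.subtypeL (J u) = T u := by
  let S : E →L[𝕜] G := T.codRestrict G fun u => (hG _).2 ⟨u, rfl⟩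
  have hker : S.ker = ⊥ :=
    LinearMap.ker_eq_bot.2 fun u v huv => hT.injective (congrArg Subtype.val huv)
  have hrange : S.range = ⊤ := LinearMap.range_eq_top.2 fun q =>
    let ⟨u, hu⟩ := (hG q).1 q.2
    ⟨u, Subtype.ext hu⟩
  exact ⟨.ofBijective S hker hrange, fun u => rfl⟩

theorem mem_g0_iff (q : L2Vec 𝕜 Ω) : q ∈ g0 𝕜 Ω ↔ ∃ u, grad 𝕜 Ω u = q := Iff.rfl

theorem exists_gradEquiv (hN : 1 ≤ N) (hΩ : Bornology.IsBounded (Ω : Set (Vec ℝ N)))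
    [CompleteSpace (g0 𝕜 Ω)] :
    ∃ J : H10 𝕜 Ω ≃L[𝕜] g0 𝕜 Ω, ∀ u, iota 𝕜 Ω (J u) = grad 𝕜 Ω u := by
  obtain ⟨K, hK⟩ := exists_antilipschitz_grad (𝕜 := 𝕜) hN hΩ
  exact exists_equiv_range_of_antilipschitz (E := H10 𝕜 Ω) (grad 𝕜 Ω) hK (g0 𝕜 Ω) mem_g0_iff

/-! ### Coercivity and invertibility of the compression. -/

theorem le_re_inner_mulOp {α β : ℝ} {a : Coeff 𝕜 Ω} (ha : a ∈ M 𝕜 α β Ω) (q : L2Vec 𝕜 Ω) :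
    α * ‖q‖ ^ 2 ≤ RCLike.re (inner 𝕜 (mulOp a q) q) := by
  rw [L2_norm_sq_eq_integral (𝕜 := 𝕜), ← integral_const_mul, L2.inner_def, ← integral_re
    (L2.integrable_inner _ _)]
  refine integral_mono_ae (((Lp.memLp q).integrable_norm_pow (by simp)).const_mul _)
    (L2.integrable_inner _ _).re ?_
  filter_upwards [ha, (ContinuousLinearMap.id 𝕜 (Vec 𝕜 N →L[𝕜] Vec 𝕜 N)).coeFn_holder
    (r := 2) a q] with x hx hq
  have h : mulOp a q x = a x (q x) := hq
  simp only [h]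
  exact hx.2.1 (q x)

theorem inner_compression [CompleteSpace (g0 𝕜 Ω)] (a : Coeff 𝕜 Ω) (p q : g0 𝕜 Ω) :
    inner 𝕜 (compression a p) q = inner 𝕜 (mulOp a (iota 𝕜 Ω p)) (iota 𝕜 Ω q) :=
  ContinuousLinearMap.adjoint_inner_left (iota 𝕜 Ω) q (mulOp a (iota 𝕜 Ω p))

/-- Lax–Milgram: coercivity bounds `‖⟨T x, x⟩‖` below by `α ‖x‖²`. -/
theorem isInvertible_of_coercive {E : Type*} [NormedAddCommGroup E] [InnerProductSpace 𝕜 E]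
    [CompleteSpace E] {T : E →L[𝕜] E} {α : ℝ} (hα : 0 < α)
    (h : ∀ x, α * ‖x‖ ^ 2 ≤ RCLike.re (inner 𝕜 (T x) x)) : T.IsInvertible := by
  obtain ⟨e, he⟩ : IsUnit T := by
    refine ContinuousLinearMap.isUnit_of_forall_le_norm_inner_map _ (c := α.toNNReal)
      (Real.toNNReal_pos.2 hα) fun x => ?_
    rw [mul_comm, Real.coe_toNNReal _ hα.le]
    exact (h x).trans (RCLike.re_le_norm _)
  exact ⟨ContinuousLinearEquiv.unitsEquiv 𝕜 _ e, he⟩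

theorem isInvertible_compression [CompleteSpace (g0 𝕜 Ω)] {α β : ℝ} (hα : 0 < α)
    {a : Coeff 𝕜 Ω} (ha : a ∈ M 𝕜 α β Ω) : (compression a).IsInvertible := by
  refine isInvertible_of_coercive hα fun x => ?_
  rw [inner_compression]
  exact le_re_inner_mulOp ha (iota 𝕜 Ω x)

/-! ### The variational problem as an operator equation, and weak convergence. -/

theorem isSolution_iff [CompleteSpace (g0 𝕜 Ω)] {J : H10 𝕜 Ω ≃L[𝕜] g0 𝕜 Ω}
    (hJ : ∀ u, iota 𝕜 Ω (J u) = grad 𝕜 Ω u) {a : Coeff 𝕜 Ω}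
    (ha : (compression a).IsInvertible) {f : StrongDual 𝕜 (H10 𝕜 Ω)} {g : g0 𝕜 Ω}
    (hf : ∀ φ, f φ = inner 𝕜 g (J φ)) {u : H10 𝕜 Ω} :
    IsSolution a f u ↔ J u = (compression a).inverse g := by
  have h1 : ∀ φ, inner 𝕜 (mulOp a (grad 𝕜 Ω u)) (grad 𝕜 Ω φ) =
      inner 𝕜 (compression a (J u)) (J φ) := fun φ => by
    rw [inner_compression, hJ, hJ]
  have h2 : IsSolution a f u ↔ compression a (J u) = g := by
    simp only [IsSolution, h1, hf]
    -- Surjectivity of `J` is what makes the gradients `J φ` exhaust all test vectors `q` of `g0`.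
    refine ⟨fun h => ext_inner_right 𝕜 fun q => ?_, fun h φ => by rw [h]⟩
    simpa using h (J.symm q)
  rw [h2]
  constructor
  · rintro rfl
    rw [ha.inverse_apply_self]
  · intro h
    rw [h, ha.self_apply_inverse]

theorem weaklyTendsto_iff {H : Type*} [NormedAddCommGroup H] [InnerProductSpace 𝕜 H]
    {x : ℕ → H} {y : H} :
    WeaklyTendsto 𝕜 x y ↔ ∀ l : StrongDual 𝕜 H, Tendsto (fun n => l (x n)) atTop (𝓝 (l y)) := by
  refine WeakBilin.tendsto_iff_forall_eval_tendsto (topDualPairing 𝕜 H).flip ?_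
  intro x y hxy
  exact (SeparatingDual.eq_iff_forall_dual_eq (R := 𝕜)).2 fun l => LinearMap.congr_fun hxy l

theorem WeaklyTendsto.map {H K : Type*} [NormedAddCommGroup H] [InnerProductSpace 𝕜 H]
    [NormedAddCommGroup K] [InnerProductSpace 𝕜 K] {x : ℕ → H} {y : H}
    (h : WeaklyTendsto 𝕜 x y) (T : H →L[𝕜] K) : WeaklyTendsto 𝕜 (fun n => T (x n)) (T y) :=
  weaklyTendsto_iff.2 fun l => weaklyTendsto_iff.1 h (l ∘L T)

theorem wotTendsto_iff {H K : Type*} [NormedAddCommGroup H] [InnerProductSpace 𝕜 H]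
    [NormedAddCommGroup K] [InnerProductSpace 𝕜 K] {T : ℕ → H →L[𝕜] K} {S : H →L[𝕜] K} :
    WOTTendsto T S ↔ ∀ x, WeaklyTendsto 𝕜 (fun n => T n x) (S x) := by
  simp only [weaklyTendsto_iff]
  exact ContinuousLinearMapWOT.tendsto_iff_forall_dual_apply_tendsto

/-- The Riesz vector of `f ∘ J⁻¹` on `g0`; this is how `H⁻¹` is replaced by `g0`. -/
theorem exists_riesz_gradEquiv [CompleteSpace (g0 𝕜 Ω)] (J : H10 𝕜 Ω ≃L[𝕜] g0 𝕜 Ω)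
    (f : StrongDual 𝕜 (H10 𝕜 Ω)) : ∃ g : g0 𝕜 Ω, ∀ φ, f φ = inner 𝕜 g (J φ) := by
  refine ⟨(InnerProductSpace.toDual 𝕜 _).symm (f ∘L (J.symm : g0 𝕜 Ω →L[𝕜] H10 𝕜 Ω)),
    fun φ => ?_⟩
  rw [InnerProductSpace.toDual_symm_apply]
  simp

/-! ### The two characterisations. -/

theorem gConverges_iff [CompleteSpace (g0 𝕜 Ω)] {J : H10 𝕜 Ω ≃L[𝕜] g0 𝕜 Ω}
    (hJ : ∀ u, iota 𝕜 Ω (J u) = grad 𝕜 Ω u) {a : ℕ → Coeff 𝕜 Ω} {b : Coeff 𝕜 Ω}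
    (ha : ∀ n, (compression (a n)).IsInvertible) (hb : (compression b).IsInvertible) :
    GConverges a b ↔
      WOTTendsto (fun n => (compression (a n)).inverse) (compression b).inverse := by
  rw [wotTendsto_iff]
  constructor
  · intro h g
    have hf : ∀ φ, (innerSL 𝕜 g ∘L (J : H10 𝕜 Ω →L[𝕜] g0 𝕜 Ω)) φ = inner 𝕜 g (J φ) :=
      fun φ => rfl
    obtain ⟨v, hv, hvb⟩ := h _ (fun n => J.symm ((compression (a n)).inverse g))
      fun n => (isSolution_iff hJ (ha n) hf).2 (J.apply_symm_apply _)
    have := hv.map (J : H10 𝕜 Ω →L[𝕜] g0 𝕜 Ω)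
    simpa [(isSolution_iff hJ hb hf).1 hvb] using this
  · intro h f u hu
    obtain ⟨g, hf⟩ := exists_riesz_gradEquiv J f
    refine ⟨J.symm ((compression b).inverse g), ?_,
      (isSolution_iff hJ hb hf).2 (J.apply_symm_apply _)⟩
    have := (h g).map (K := H10 𝕜 Ω) (J.symm : g0 𝕜 Ω →L[𝕜] H10 𝕜 Ω)
    simpa [← (isSolution_iff hJ (ha _) hf).1 (hu _)] using this

theorem hConverges_iff [CompleteSpace (g0 𝕜 Ω)] {J : H10 𝕜 Ω ≃L[𝕜] g0 𝕜 Ω}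
    (hJ : ∀ u, iota 𝕜 Ω (J u) = grad 𝕜 Ω u) {a : ℕ → Coeff 𝕜 Ω} {b : Coeff 𝕜 Ω}
    (ha : ∀ n, (compression (a n)).IsInvertible) (hb : (compression b).IsInvertible) :
    HConverges a b ↔
      WOTTendsto (fun n => (compression (a n)).inverse) (compression b).inverse ∧
      WOTTendsto (fun n => mulOp (a n) ∘L iota 𝕜 Ω ∘L (compression (a n)).inverse)
        (mulOp b ∘L iota 𝕜 Ω ∘L (compression b).inverse) := by
  have hgrad : ∀ g, grad 𝕜 Ω (J.symm g) = iota 𝕜 Ω g := fun g => by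
    rw [← hJ, J.apply_symm_apply]
  constructor
  · intro h
    -- Forgetting the fluxes leaves the defining condition of `GConverges`, which yields the first
    -- limit; the second is the flux condition for the functional `⟨g, J ·⟩`.
    refine ⟨(gConverges_iff hJ ha hb).1 fun f u hu => ?_, wotTendsto_iff.2 fun g => ?_⟩
    · obtain ⟨v, hv, -, hvb⟩ := h f u hu
      exact ⟨v, hv, hvb⟩
    · have hf : ∀ φ, (innerSL 𝕜 g ∘L (J : H10 𝕜 Ω →L[𝕜] g0 𝕜 Ω)) φ = inner 𝕜 g (J φ) :=
        fun φ => rfl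
      obtain ⟨v, -, hv, hvb⟩ := h _ (fun n => J.symm ((compression (a n)).inverse g))
        fun n => (isSolution_iff hJ (ha n) hf).2 (J.apply_symm_apply _)
      simp only [hgrad] at hv
      rw [← hJ, (isSolution_iff hJ hb hf).1 hvb] at hv
      exact hv
  · rintro ⟨h, h'⟩ f u hu
    obtain ⟨v, hv, hvb⟩ := (gConverges_iff hJ ha hb).2 h f u hu
    obtain ⟨g, hf⟩ := exists_riesz_gradEquiv J f
    refine ⟨v, hv, ?_, hvb⟩
    -- Solutions are unique, so `u n` and `v` are the ones given by the inverses and their fluxes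
    -- are the operators in `h'` applied to `g`.
    simp only [← hJ, (isSolution_iff hJ hb hf).1 hvb,
      fun n => (isSolution_iff hJ (ha n) hf).1 (hu n)]
    exact wotTendsto_iff.1 h' g

end Homogenisation

theorem mainTheorem3 {𝕜 : Type*} [RCLike 𝕜] {N : ℕ} (hN : 1 ≤ N)
    (Ω : TopologicalSpace.Opens (EuclideanSpace ℝ (Fin N)))
    (hΩ : Bornology.IsBounded (Ω : Set (EuclideanSpace ℝ (Fin N))))
    {α β : ℝ} (hα : 0 < α) (hαβ : α < β) :
    -- `g₀(Ω)` is a Hilbert space and the inverses below are genuine inverses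
    ∃ _ : CompleteSpace (g0 𝕜 Ω),
      (∀ c ∈ M 𝕜 α β Ω, (compression c).IsInvertible) ∧
      -- (a)
      (∀ (a : ℕ → Coeff 𝕜 Ω) (b : Coeff 𝕜 Ω),
        (∀ n, a n ∈ Msym 𝕜 α β Ω) → b ∈ Msym 𝕜 α β Ω →
        (GConverges a b ↔
          WOTTendsto (fun n => (compression (a n)).inverse) (compression b).inverse)) ∧
      -- (b)
      (∀ (a : ℕ → Coeff 𝕜 Ω) (b : Coeff 𝕜 Ω),
        (∀ n, a n ∈ M 𝕜 α β Ω) → b ∈ M 𝕜 α β Ω →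
        (HConverges a b ↔
          WOTTendsto (fun n => (compression (a n)).inverse) (compression b).inverse ∧
          WOTTendsto (fun n => mulOp (a n) ∘L iota 𝕜 Ω ∘L (compression (a n)).inverse)
            (mulOp b ∘L iota 𝕜 Ω ∘L (compression b).inverse))) := by
  have hc : CompleteSpace (g0 𝕜 Ω) := completeSpace_g0 hN hΩ
  obtain ⟨J, hJ⟩ := exists_gradEquiv (𝕜 := 𝕜) hN hΩ
  have hinv : ∀ c ∈ M 𝕜 α β Ω, (compression c).IsInvertible :=
    fun c hc => isInvertible_compression hα hc
  exact ⟨hc, hinv,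
    fun a b ha hb => gConverges_iff hJ (fun n => hinv _ (ha n).1) (hinv _ hb.1),
    fun a b ha hb => hConverges_iff hJ (fun n => hinv _ (ha n)) (hinv _ hb)⟩
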